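/- Let $\{x(n)\}_{n\in\mathbb Z}$ be a complex second-order random process with autocorrelation $r_x(n,m)=\mathbb E[x(n+m)x^*(n)]$ satisfying $\sum_{m\in\mathbb Z}\sup_{n}|r_x(n,m)|^2<\infty$, and with average power $P_x=\lim_{N\to\infty}\frac1N\sum_{n=-N/2}^{N/2-1}\mathbb E|x(n)|^2\in(0,\infty)$. Throughout, $N$ is even and limits of functions of $\lambda\in[0,1)$ are limits in Lebesgue measure (which covers limits almost everywhere and in $L^p$). A family $\{\theta(n,\lambda)\}_{n\in\mathbb Z,\ \lambda\in[0,1)}$ with $\theta(n,\cdot)\in L^2[0,1)$ is called a *unitary basis* if $\int_0^1\theta(n,\lambda)\theta^*(n',\lambda)\,d\lambda=\delta_{n-n'}$, if $\sum_{n}\theta(n,\lambda)\theta^*(n,\lambda')=\delta(\lambda-\lambda')$ as an identity of kernels acting on $L^2[0,1)$, and if this relation is normalized on the diagonal, $\lim_{N\to\infty}\frac1N\sum_{n=-N/2}^{N/2-1}|\theta(n,\lambda)|^2=1$. The process has *spectrum* $\mathcal S_{\mathcal X,\theta}$ in this basis if $$\mathcal S_{\mathcal X,\theta}(\lambda)=\lim_{N\to\infty}\frac1N\,\mathbb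 E\Bigl|\sum_{n=-N/2}^{N/2-1}x(n)\theta^*(n,\lambda)\Bigr|^2 .$$ The *representation entropy* is then $\mathrm h(\{\theta\})=-\int_0^1 \mathrm p_{x,\theta}(\lambda)\ln \mathrm p_{x,\theta}(\lambda)\,d\lambda$ with $\mathrm p_{x,\theta}=\mathcal S_{\mathcal X,\theta}/P_x$. A *Karhunen–Loève (KL) basis* of $x$ with KL spectrum $\mathcal S_{\mathcal X}:[0,1)\to\mathbb R$ is a unitary basis $\{\phi(n,\lambda)\}$ such that, for every $k\in\mathbb Z$, $$\sum_{l\in\mathbb Z}r_x(l,k-l)\,\phi(l,\lambda)=\mathcal S_{\mathcal X}(\lambda)\,\phi(k,\lambda),$$ the sum being the limit of its partial sums over $-N/2\le l<N/2$. Let $\{\phi(n,\lambda)\}$ be a KL basis of $x$ with KL spectrum $\mathcal S_{\mathcal X}$. Then the spectrum of $x$ in the basis $\{\phi\}$ exists and is $\mathcal S_{\mathcal X,\phi}=\mathcal S_{\mathcal X}$. For $\phi$, and for every unitary basis $\{\theta(n,\lambda)\}$ in which $x$ has a spectrum, the normalized spectrum is a probability density on $[0,1)$ whose representation entropy is a convergent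 integral. The KL basis has the minimum representation entropy: $$\mathrm h(\{\phi(n,\lambda)\})\le \mathrm h(\{\theta(n,\lambda)\})\qquad\text{for all such }\{\theta(n,\lambda)\}.$$ -/

import Mathlib

namespace SpectralEntropy

noncomputable section

open MeasureTheory Filter

/-- The spectral domain `[0, 1)` with Lebesgue measure. -/
def specMeasure : Measure ℝ := volume.restrict (Set.Ico (0 : ℝ) 1)

/-- The time window `{-N/2, …, N/2 - 1}` for the even length `N = 2 * M`. -/
def window (M : ℕ) : Finset ℤ := Finset.Ico (-(M : ℤ)) (M : ℤ)

/-- Orthonormal (unitary) bases `θ(n, s)`, `n ∈ ℤ`, `s ∈ [0, 1)`.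

* `orthonormal`: `∫₀¹ θ(n, s) θ*(n', s) ds = δ_{n - n'}`.
* `complete`: `∑ₙ θ(n, s) θ*(n, s') = δ(s - s')`, as an identity of kernels acting on `L²[0, 1)`.
* `normalized`: the same relation on the diagonal `s = s'`, where a window of length `N` resolves
  the spectral domain into cells `ds = 1 / N`, so that `δ(0) ds = 1`:
  `(1 / N) ∑_{n = -N/2}^{N/2 - 1} |θ(n, s)|² → 1`.

Limits of functions of `s` are taken in measure, which is weaker than almost everywhere
convergence and than convergence in any `Lᵖ` norm. -/
structure IsUnitaryBasis (θ : ℤ → ℝ → ℂ) : Prop where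
  memLp : ∀ n, MemLp (θ n) 2 specMeasure
  orthonormal : ∀ n n' : ℤ,
    ∫ s, θ n s * star (θ n' s) ∂specMeasure = if n = n' then 1 else 0
  complete : ∀ g : ℝ → ℂ, MemLp g 2 specMeasure →
    Tendsto (fun M : ℕ => eLpNorm
      (fun s => (∑ n ∈ window M, θ n s * ∫ s', star (θ n s') * g s' ∂specMeasure) - g s)
      2 specMeasure) atTop (nhds 0)
  normalized : TendstoInMeasure specMeasure
    (fun (M : ℕ) s => (1 / (2 * M : ℝ)) * ∑ n ∈ window M, ‖θ n s‖ ^ 2) atTop (fun _ => (1 : ℝ))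

variable {Ω : Type*} [MeasurableSpace Ω]

/-- The autocorrelation `r(n, m) = E[x(n + m) x*(n)]` at time `n` and lag `m`. -/
def autocorr (Pr : Measure Ω) (x : ℤ → Ω → ℂ) (n m : ℤ) : ℂ :=
  ∫ ω, x (n + m) ω * star (x n ω) ∂Pr

/-- The autocorrelation is square-summable in the lag, uniformly in time:
`∑ₘ supₙ |r(n, m)|² < ∞`. -/
def SquareSummableAutocorr (Pr : Measure Ω) (x : ℤ → Ω → ℂ) : Prop :=
  ∃ a : ℤ → ℝ, Summable (fun m => a m ^ 2) ∧ ∀ n m, ‖autocorr Pr x n m‖ ≤ a m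

/-- `P` is the average power `lim (1 / N) ∑_{n = -N/2}^{N/2 - 1} E|x(n)|²`. -/
def HasAveragePower (Pr : Measure Ω) (x : ℤ → Ω → ℂ) (P : ℝ) : Prop :=
  Tendsto (fun M : ℕ => (1 / (2 * M : ℝ)) * ∑ n ∈ window M, ∫ ω, ‖x n ω‖ ^ 2 ∂Pr)
    atTop (nhds P)

/-- `S` is the power spectrum of `x` in the basis `θ`, that is, `E|dη(s)|² = S(s) ds` for the
spectral increments `dη(s) = lim (1 / N) ∑_{n = -N/2}^{N/2 - 1} x(n) θ*(n, s)` with `ds = 1 / N`: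
`S(s) = lim (1 / N) E|∑_{n = -N/2}^{N/2 - 1} x(n) θ*(n, s)|²`. -/
def HasSpectrum (Pr : Measure Ω) (x : ℤ → Ω → ℂ) (θ : ℤ → ℝ → ℂ) (S : ℝ → ℝ) : Prop :=
  TendstoInMeasure specMeasure
    (fun (M : ℕ) s =>
      (1 / (2 * M : ℝ)) * ∫ ω, ‖∑ n ∈ window M, x n ω * star (θ n s)‖ ^ 2 ∂Pr) atTop S

/-- `φ` is a Karhunen–Loève basis of `x` with Karhunen–Loève spectrum `S`: it is a unitary basis
and it solves the eigenequation `∑ₗ r(l, k - l) φ(l, s) = S(s) φ(k, s)` for every `k`. -/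
structure IsKLBasis (Pr : Measure Ω) (x : ℤ → Ω → ℂ) (φ : ℤ → ℝ → ℂ) (S : ℝ → ℝ) : Prop where
  unitary : IsUnitaryBasis φ
  eigen : ∀ k : ℤ, TendstoInMeasure specMeasure
    (fun (M : ℕ) s => ∑ l ∈ window M, autocorr Pr x l (k - l) * φ l s) atTop
    (fun s => (S s : ℂ) * φ k s)

/-- The normalized spectrum `p = S / P`. -/
def normSpectrum (P : ℝ) (S : ℝ → ℝ) (s : ℝ) : ℝ := S s / P

/-- The normalized spectrum is a probability density on `[0, 1)` whose differential entropy is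
a convergent integral. -/
structure EntropyDefined (P : ℝ) (S : ℝ → ℝ) : Prop where
  nonneg : ∀ᵐ s ∂specMeasure, 0 ≤ normSpectrum P S s
  integrable : Integrable (normSpectrum P S) specMeasure
  integral_eq_one : ∫ s, normSpectrum P S s ∂specMeasure = 1
  integrable_log :
    Integrable (fun s => normSpectrum P S s * Real.log (normSpectrum P S s)) specMeasure

/-- The representation entropy `h = -∫₀¹ p(s) ln p(s) ds`. -/
def repEntropy (P : ℝ) (S : ℝ → ℝ) : ℝ :=
  -∫ s, normSpectrum P S s * Real.log (normSpectrum P S s) ∂specMeasure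

end

end SpectralEntropy

namespace SpectralEntropy

open MeasureTheory Filter Topology

/-! The correlation matrix `R k l = E[x(k) x*(l)]` acts on the KL basis as multiplication by `S`, so
the spectrum in any other basis is an average of `S`, and averaging can only raise entropy. In
detail, the length-`N` periodogram in a basis `θ` equals `∫ S(s') K(s, s') ds'` with the nonnegative
kernel `K = (1/N) |∑ θ*(k, s) φ(k, s')|²` (`transition`). By Parseval its marginals are the window
averages of `|θ|²` and `|φ|²`, which tend to `1` in mean by Scheffé: the kernel is asymptotically
doubly stochastic. Jensen in `s'`, Tonelli, and Fatou along an a.e. convergent subsequence give `∫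
Φ(Sθ) ≤ ∫ Φ(S)` for every nonnegative continuous convex `Φ` of subquadratic growth
(`integrable_and_integral_map_le`). Taking `Φ` to be `t`, `(K - t)⁺` and a shifted `p ln p` yields
equality of mass and then the entropy inequality. The rows of `R` are only square-summable, so `S`
is controlled only in `L²`; hence the growth condition on `Φ`. That the spectrum in `φ` is `S`
follows because truncating the rows of `R` to the window costs a vanishing average error. -/

/-! ### Measure theory: Fatou, Scheffé, weights tending to one, Jensen -/

/-- Fatou's lemma for real integrals with convergent upper bounds. -/
theorem integrable_and_integral_le_of_tendsto {α : Type*} [MeasurableSpace α] {μ : Measure α}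
    {u : ℕ → α → ℝ} {v : α → ℝ} {c : ℕ → ℝ} {c₀ : ℝ}
    (hm : ∀ n, AEMeasurable (u n) μ) (h0 : ∀ n, ∀ᵐ s ∂μ, 0 ≤ u n s)
    (hu : ∀ n, ∫⁻ s, ENNReal.ofReal (u n s) ∂μ ≤ ENNReal.ofReal (c n))
    (hc : Tendsto c atTop (𝓝 c₀))
    (hlim : ∀ᵐ s ∂μ, Tendsto (fun n => u n s) atTop (𝓝 (v s))) (hc₀ : 0 ≤ c₀) :
    Integrable v μ ∧ ∫ s, v s ∂μ ≤ c₀ := by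
  have hv : AEMeasurable v μ := aemeasurable_of_tendsto_metrizable_ae atTop hm hlim
  have hv0 : ∀ᵐ s ∂μ, 0 ≤ v s := by
    filter_upwards [hlim, ae_all_iff.2 h0] with s hs h0s
    exact ge_of_tendsto' hs h0s
  have key : ∫⁻ s, ENNReal.ofReal (v s) ∂μ ≤ ENNReal.ofReal c₀ := by
    calc ∫⁻ s, ENNReal.ofReal (v s) ∂μ
        = ∫⁻ s, liminf (fun n => ENNReal.ofReal (u n s)) atTop ∂μ := by
          refine lintegral_congr_ae ?_
          filter_upwards [hlim] with s hs
          exact ((ENNReal.continuous_ofReal.tendsto _).comp hs).liminf_eq.symm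
      _ ≤ liminf (fun n => ∫⁻ s, ENNReal.ofReal (u n s) ∂μ) atTop :=
          lintegral_liminf_le' fun n => (hm n).ennreal_ofReal
      _ ≤ liminf (fun n => ENNReal.ofReal (c n)) atTop := liminf_le_liminf (.of_forall hu)
      _ = ENNReal.ofReal c₀ := ((ENNReal.continuous_ofReal.tendsto _).comp hc).liminf_eq
  have hint : Integrable v μ := by
    refine ⟨hv.aestronglyMeasurable, ?_⟩
    rw [hasFiniteIntegral_iff_ofReal hv0]
    exact key.trans_lt ENNReal.ofReal_lt_top
  refine ⟨hint, ?_⟩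
  rw [integral_eq_lintegral_of_nonneg_ae hv0 hv.aestronglyMeasurable]
  exact ENNReal.toReal_le_of_le_ofReal hc₀ key

theorem integrable_and_integral_le_of_tendsto' {α : Type*} [MeasurableSpace α] {μ : Measure α}
    {u : ℕ → α → ℝ} {v : α → ℝ} {c : ℕ → ℝ} {c₀ : ℝ}
    (hi : ∀ n, Integrable (u n) μ) (h0 : ∀ n, ∀ᵐ s ∂μ, 0 ≤ u n s)
    (hu : ∀ n, ∫ s, u n s ∂μ ≤ c n) (hc : Tendsto c atTop (𝓝 c₀))
    (hlim : ∀ᵐ s ∂μ, Tendsto (fun n => u n s) atTop (𝓝 (v s))) :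
    Integrable v μ ∧ ∫ s, v s ∂μ ≤ c₀ := by
  refine integrable_and_integral_le_of_tendsto (fun n => (hi n).1.aemeasurable) h0 (fun n => ?_)
    hc hlim (ge_of_tendsto' hc fun n => (integral_nonneg_of_ae (h0 n)).trans (hu n))
  rw [← ofReal_integral_eq_lintegral_ofReal (hi n) (h0 n)]
  exact ENNReal.ofReal_le_ofReal (hu n)

/-- Convergence in mean implies convergence in measure. -/
theorem tendstoInMeasure_of_tendsto_integral_abs {α : Type*} [MeasurableSpace α] {μ : Measure α}
    {u : ℕ → α → ℝ} {v : α → ℝ} (hu : ∀ n, Integrable (u n) μ) (hv : Integrable v μ)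
    (h : Tendsto (fun n => ∫ s, |u n s - v s| ∂μ) atTop (𝓝 0)) :
    TendstoInMeasure μ u atTop v := by
  refine tendstoInMeasure_of_tendsto_eLpNorm one_ne_zero (fun n => (hu n).1) hv.1 ?_
  have h' := (ENNReal.continuous_ofReal.tendsto _).comp h
  rw [ENNReal.ofReal_zero] at h'
  refine h'.congr fun n => ?_
  rw [eLpNorm_one_eq_lintegral_enorm, ← ofReal_integral_norm_eq_lintegral_enorm ((hu n).sub hv)]
  rfl

/-- Scheffé's lemma for convergence in measure to `1`. -/
theorem tendsto_integral_abs_sub_one {α : Type*} [MeasurableSpace α] {μ : Measure α}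
    [IsProbabilityMeasure μ] {g : ℕ → α → ℝ} (hi : ∀ n, Integrable (g n) μ)
    (h0 : ∀ n s, 0 ≤ g n s) (hg : Tendsto (fun n => ∫ s, g n s ∂μ) atTop (𝓝 1))
    (hm : TendstoInMeasure μ g atTop (fun _ => (1 : ℝ))) :
    Tendsto (fun n => ∫ s, |g n s - 1| ∂μ) atTop (𝓝 0) := by
  -- The deficit `(1 - g)⁺` lies in `[0, 1]`, so dominated convergence applies along a.e. convergent
  -- subsequences. Convergence of the total mass then controls the excess, through `|y| = y + 2 y⁻`.
  have hneg : Tendsto (fun n => ∫ s, max (1 - g n s) 0 ∂μ) atTop (𝓝 0) := by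
    refine tendsto_of_subseq_tendsto fun ns hns => ?_
    obtain ⟨ms, -, hms⟩ := (hm.comp hns).exists_seq_tendsto_ae
    refine ⟨ms, ?_⟩
    have := tendsto_integral_of_dominated_convergence (μ := μ)
      (F := fun n s => max (1 - g (ns (ms n)) s) 0) (f := fun _ => (0 : ℝ)) (fun _ => (1 : ℝ))
      (fun n => ((integrable_const (1 : ℝ)).sub (hi _)).pos_part.1) (integrable_const _)
      (fun n => Eventually.of_forall fun s => ?_) ?_
    · simpa using this
    · rw [Real.norm_of_nonneg (le_max_right _ _)]
      exact max_le (by linarith [h0 (ns (ms n)) s]) zero_le_one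
    · filter_upwards [hms] with s hs
      have := ((tendsto_const_nhds (x := (1 : ℝ))).sub hs).max
        (tendsto_const_nhds (x := (0 : ℝ)))
      simpa using this
  have heq : ∀ n, ∫ s, |g n s - 1| ∂μ
      = (∫ s, g n s ∂μ - 1) + 2 * ∫ s, max (1 - g n s) 0 ∂μ := by
    intro n
    have h1 : Integrable (fun s => g n s - 1) μ := (hi n).sub (integrable_const _)
    have h2 : Integrable (fun s => max (1 - g n s) 0) μ :=
      ((integrable_const (1 : ℝ)).sub (hi n)).pos_part
    have h3 : ∫ s, g n s ∂μ - 1 = ∫ s, (g n s - 1) ∂μ := by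
      rw [integral_sub (hi n) (integrable_const _)]; simp
    rw [h3, ← integral_const_mul, ← integral_add h1 (h2.const_mul 2)]
    refine integral_congr_ae (Eventually.of_forall fun s => ?_)
    rcases le_total (g n s) 1 with h | h
    · simp only
      rw [abs_of_nonpos (by linarith), max_eq_left (by linarith)]; ring
    · simp only
      rw [abs_of_nonneg (by linarith), max_eq_right (by linarith)]; ring
  simp_rw [heq]
  simpa using (hg.sub_const 1).add (hneg.const_mul 2)

/-- If the weights `g n` tend to `1` in mean and `S²` has bounded weighted means, then every
function of subquadratic growth in `S` is integrated by the weights up to a vanishing error. -/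
theorem tendsto_integral_mul_abs_sub_one {α : Type*} [MeasurableSpace α] {μ : Measure α}
    [IsProbabilityMeasure μ] {g : ℕ → α → ℝ} {S f : α → ℝ} {A : ℝ} (hi : ∀ n, Integrable (g n) μ)
    (h0 : ∀ n s, 0 ≤ g n s) (hg : Tendsto (fun n => ∫ s, |g n s - 1| ∂μ) atTop (𝓝 0))
    (hS : Integrable (fun s => S s ^ 2) μ) (hSA : ∫ s, S s ^ 2 ∂μ ≤ A)
    (hSg : ∀ n, Integrable (fun s => S s ^ 2 * g n s) μ)
    (hSgA : ∀ n, ∫ s, S s ^ 2 * g n s ∂μ ≤ A) (hf : AEStronglyMeasurable f μ)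
    (hfS : ∀ ε > 0, ∃ C, ∀ᵐ s ∂μ, |f s| ≤ ε * S s ^ 2 + C) :
    Integrable f μ ∧ (∀ n, Integrable (fun s => f s * g n s) μ) ∧
      Tendsto (fun n => ∫ s, |f s * g n s - f s| ∂μ) atTop (𝓝 0) := by
  have hfi : Integrable f μ := by
    obtain ⟨C, hC⟩ := hfS 1 one_pos
    refine Integrable.mono' ((hS.const_mul 1).add (integrable_const C)) hf ?_
    filter_upwards [hC] with s hs using hs
  have hfg : ∀ n, Integrable (fun s => f s * g n s) μ := by
    intro n
    obtain ⟨C, hC⟩ := hfS 1 one_pos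
    refine Integrable.mono' (((hSg n).const_mul 1).add ((hi n).const_mul C)) (hf.mul (hi n).1) ?_
    filter_upwards [hC] with s hs
    rw [norm_mul, Real.norm_of_nonneg (h0 n s)]
    have := mul_le_mul_of_nonneg_right hs (h0 n s)
    simp only [Pi.add_apply]
    rw [Real.norm_eq_abs]
    linarith
  refine ⟨hfi, hfg, ?_⟩
  have hA : 0 ≤ A := (integral_nonneg fun s => sq_nonneg _).trans hSA
  rw [Metric.tendsto_atTop']
  intro ε hε
  -- The two integrals of `S²` total at most `2 * A`, so this share costs at most `ε / 2`; `A + 1`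
  -- avoids a zero denominator. The bounded part `C` is left to the convergence of `g`.
  obtain ⟨C, hC⟩ := hfS (ε / (4 * (A + 1))) (by positivity)
  have hev := (hg.const_mul |C|)
  rw [mul_zero] at hev
  obtain ⟨N, hN⟩ := eventually_atTop.1 (hev.eventually (gt_mem_nhds (half_pos hε)))
  refine ⟨N, fun n hn => ?_⟩
  have hNn := hN n hn.le
  rw [Real.dist_eq, sub_zero, abs_of_nonneg (integral_nonneg fun s => abs_nonneg _)]
  have h1 : Integrable (fun s => |g n s - 1|) μ := ((hi n).sub (integrable_const 1)).abs
  have h2 : Integrable (fun s => S s ^ 2 * g n s + S s ^ 2) μ := (hSg n).add hS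
  have hle : ∫ s, |f s * g n s - f s| ∂μ ≤
      ∫ s, (ε / (4 * (A + 1)) * (S s ^ 2 * g n s + S s ^ 2) + |C| * |g n s - 1|) ∂μ := by
    refine integral_mono_ae ((hfg n).sub hfi).abs
      ((h2.const_mul _).add (h1.const_mul _)) ?_
    filter_upwards [hC] with s hs
    have e1 : f s * g n s - f s = f s * (g n s - 1) := by ring
    have e2 : |g n s - 1| ≤ g n s + 1 := by
      rw [abs_le]; constructor <;> linarith [h0 n s]
    rw [e1, abs_mul]
    have e3 : 0 ≤ ε / (4 * (A + 1)) * S s ^ 2 := by positivity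
    calc |f s| * |g n s - 1| ≤ (ε / (4 * (A + 1)) * S s ^ 2 + |C|) * |g n s - 1| := by
          gcongr; linarith [le_abs_self C]
      _ = ε / (4 * (A + 1)) * S s ^ 2 * |g n s - 1| + |C| * |g n s - 1| := by ring
      _ ≤ ε / (4 * (A + 1)) * S s ^ 2 * (g n s + 1) + |C| * |g n s - 1| := by gcongr
      _ = _ := by ring
  rw [integral_add (h2.const_mul _) (h1.const_mul _), integral_const_mul,
    integral_const_mul, integral_add (hSg n) hS] at hle
  have h3 : ε / (4 * (A + 1)) * (∫ s, S s ^ 2 * g n s ∂μ + ∫ s, S s ^ 2 ∂μ) ≤ ε / 2 := by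
    calc _ ≤ ε / (4 * (A + 1)) * (2 * (A + 1)) := by
          gcongr; linarith [hSgA n]
      _ = ε / 2 := by field_simp; ring
  linarith

/-- Jensen's inequality for a finite density. -/
theorem ofReal_map_average_mul_le {α : Type*} [MeasurableSpace α] {μ : Measure α} {Φ : ℝ → ℝ}
    (hΦ : ConvexOn ℝ (Set.Ici 0) Φ) (hΦc : Continuous Φ) (hΦ0 : ∀ t, 0 ≤ t → 0 ≤ Φ t)
    {w f : α → ℝ} (hw : Integrable w μ) (hw0 : ∀ s, 0 ≤ w s)
    (hf : AEStronglyMeasurable f μ) (hf0 : ∀ᵐ s ∂μ, 0 ≤ f s)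
    (hfw : Integrable (fun s => f s * w s) μ) :
    ENNReal.ofReal (Φ ((∫ s, f s * w s ∂μ) / ∫ s, w s ∂μ) * ∫ s, w s ∂μ) ≤
      ∫⁻ s, ENNReal.ofReal (Φ (f s) * w s) ∂μ := by
  -- Integrability of `Φ ∘ f` against `w` is not assumed: when it fails, the right side is infinite.
  by_cases htop : ∫⁻ s, ENNReal.ofReal (Φ (f s) * w s) ∂μ = ⊤
  · rw [htop]; exact le_top
  have hΦw0 : ∀ᵐ s ∂μ, 0 ≤ Φ (f s) * w s := by
    filter_upwards [hf0] with s hs using mul_nonneg (hΦ0 _ hs) (hw0 s)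
  have hΦw : Integrable (fun s => Φ (f s) * w s) μ := by
    refine ⟨(hΦc.comp_aestronglyMeasurable hf).mul hw.1, ?_⟩
    rw [hasFiniteIntegral_iff_ofReal hΦw0]
    exact lt_top_iff_ne_top.2 htop
  rw [← ofReal_integral_eq_lintegral_ofReal hΦw hΦw0]
  refine ENNReal.ofReal_le_ofReal ?_
  rcases (integral_nonneg hw0 : 0 ≤ ∫ s, w s ∂μ).eq_or_lt with h | hpos
  · rw [← h, mul_zero]; exact integral_nonneg_of_ae hΦw0
  -- Under the measure with density `w`, the quotient is the average of `f`, and the usual Jensen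
  -- inequality applies.
  set ν : Measure α := μ.withDensity fun s => ENNReal.ofReal (w s) with hν
  have hwm : AEMeasurable (fun s => ENNReal.ofReal (w s)) μ := hw.1.aemeasurable.ennreal_ofReal
  have hwt : ∀ᵐ s ∂μ, ENNReal.ofReal (w s) < ⊤ := .of_forall fun s => ENNReal.ofReal_lt_top
  have hint : ∀ h : α → ℝ, ∫ s, h s ∂ν = ∫ s, h s * w s ∂μ := by
    intro h
    rw [hν, integral_withDensity_eq_integral_toReal_smul₀ hwm hwt]
    refine integral_congr_ae (.of_forall fun s => ?_)
    simp [ENNReal.toReal_ofReal (hw0 s), mul_comm]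
  have hintble : ∀ h : α → ℝ, Integrable (fun s => h s * w s) μ → Integrable h ν := by
    intro h hh
    rw [hν, integrable_withDensity_iff_integrable_smul₀' hwm hwt]
    refine hh.congr (.of_forall fun s => ?_)
    simp [ENNReal.toReal_ofReal (hw0 s), mul_comm]
  have huniv : ν Set.univ = ENNReal.ofReal (∫ s, w s ∂μ) := by
    rw [hν, withDensity_apply _ MeasurableSet.univ, Measure.restrict_univ,
      ofReal_integral_eq_lintegral_ofReal hw (.of_forall hw0)]
  have : IsFiniteMeasure ν := ⟨by rw [huniv]; exact ENNReal.ofReal_lt_top⟩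
  have : NeZero ν := ⟨by
    intro h0
    rw [h0] at huniv
    simp only [Measure.coe_zero, Pi.zero_apply] at huniv
    exact absurd (ENNReal.ofReal_eq_zero.1 huniv.symm) (not_le.2 hpos)⟩
  have hJ := hΦ.map_average_le (μ := ν) (f := f) hΦc.continuousOn isClosed_Ici
    ((withDensity_absolutelyContinuous _ _).ae_le hf0) (hintble f hfw)
    (hintble (Φ ∘ f) hΦw)
  have hreal : ν.real Set.univ = ∫ s, w s ∂μ := by
    rw [measureReal_def, huniv, ENNReal.toReal_ofReal hpos.le]
  rw [average_eq, average_eq, hint, hint, hreal, smul_eq_mul, smul_eq_mul] at hJ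
  rw [div_eq_inv_mul]
  calc _ ≤ ((∫ s, w s ∂μ)⁻¹ * ∫ s, Φ (f s) * w s ∂μ) * ∫ s, w s ∂μ := by gcongr
    _ = _ := by field_simp

/-! ### Second moments, Parseval and window averages -/

instance : IsProbabilityMeasure specMeasure := ⟨by simp [specMeasure]⟩

theorem integrable_mul_star {α : Type*} [MeasurableSpace α] {μ : Measure α} {f g : α → ℂ}
    (hf : MemLp f 2 μ) (hg : MemLp g 2 μ) : Integrable (fun s => f s * star (g s)) μ :=
  hf.integrable_mul hg.star

theorem integrable_norm_sq {α : Type*} [MeasurableSpace α] {μ : Measure α} {f : α → ℂ}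
    (hf : MemLp f 2 μ) : Integrable (fun s => ‖f s‖ ^ 2) μ :=
  hf.norm.integrable_sq

theorem ofReal_integral_norm_sq {α : Type*} [MeasurableSpace α] {μ : Measure α} (f : α → ℂ) :
    ((∫ s, ‖f s‖ ^ 2 ∂μ : ℝ) : ℂ) = ∫ s, f s * star (f s) ∂μ := by
  rw [← integral_complex_ofReal]
  refine integral_congr_ae (.of_forall fun s => ?_)
  have := Complex.mul_conj' (f s)
  simpa using this.symm

theorem memLp_sum_mul {α : Type*} [MeasurableSpace α] {μ : Measure α} {θ : ℤ → α → ℂ}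
    (hθ : ∀ n, MemLp (θ n) 2 μ) (F : Finset ℤ) (c : ℤ → ℂ) :
    MemLp (fun s => ∑ l ∈ F, c l * θ l s) 2 μ :=
  memLp_finsetSum F fun l _ => (hθ l).const_mul (c l)

/-- The second moment of a finite linear combination. -/
theorem ofReal_integral_norm_sq_sum {α : Type*} [MeasurableSpace α] {μ : Measure α}
    {θ : ℤ → α → ℂ} (hθ : ∀ n, MemLp (θ n) 2 μ) (F : Finset ℤ) (c : ℤ → ℂ) :
    ((∫ s, ‖∑ l ∈ F, c l * θ l s‖ ^ 2 ∂μ : ℝ) : ℂ) =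
      ∑ k ∈ F, ∑ l ∈ F, c k * star (c l) * ∫ s, θ k s * star (θ l s) ∂μ := by
  rw [ofReal_integral_norm_sq]
  have hi : ∀ k l, Integrable (fun s => c k * star (c l) * (θ k s * star (θ l s))) μ :=
    fun k l => (integrable_mul_star (hθ k) (hθ l)).const_mul _
  simp_rw [← integral_const_mul]
  rw [← integral_congr_ae (.of_forall fun s => ?_),
    integral_finsetSum _ fun k _ => integrable_finsetSum F fun l _ => hi k l]
  · exact Finset.sum_congr rfl fun k _ => integral_finsetSum _ fun l _ => hi k l
  · simp only [star_sum, star_mul', Finset.sum_mul_sum]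
    exact Finset.sum_congr rfl fun k _ => Finset.sum_congr rfl fun l _ => by ring

/-- Parseval's identity for finite linear combinations. -/
theorem IsUnitaryBasis.integral_norm_sq_sum {θ : ℤ → ℝ → ℂ} (hθ : IsUnitaryBasis θ)
    (F : Finset ℤ) (c : ℤ → ℂ) :
    ∫ s, ‖∑ l ∈ F, c l * θ l s‖ ^ 2 ∂specMeasure = ∑ l ∈ F, ‖c l‖ ^ 2 := by
  have h := ofReal_integral_norm_sq_sum hθ.memLp F c
  simp only [hθ.orthonormal, mul_ite, mul_one, mul_zero, Finset.sum_ite_eq] at h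
  rw [Finset.sum_congr rfl fun k hk => if_pos hk] at h
  apply Complex.ofReal_injective
  rw [h, Complex.ofReal_sum]
  refine Finset.sum_congr rfl fun k _ => ?_
  simpa using Complex.mul_conj' (c k)

/-- The diagonal of the resolution of the identity over a window. -/
noncomputable def diagAverage (θ : ℤ → ℝ → ℂ) (M : ℕ) (s : ℝ) : ℝ :=
  (1 / (2 * M : ℝ)) * ∑ n ∈ window M, ‖θ n s‖ ^ 2

theorem diagAverage_nonneg (θ : ℤ → ℝ → ℂ) (M : ℕ) (s : ℝ) : 0 ≤ diagAverage θ M s := by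
  unfold diagAverage; positivity

theorem card_window (M : ℕ) : (window M).card = 2 * M := by
  simp [window]; omega

theorem average_const {M : ℕ} (hM : M ≠ 0) (c : ℝ) :
    (1 / (2 * M : ℝ)) * ∑ _n ∈ window M, c = c := by
  have : (M : ℝ) ≠ 0 := by exact_mod_cast hM
  rw [Finset.sum_const, card_window, nsmul_eq_mul]
  push_cast
  field_simp

theorem average_le {f : ℤ → ℝ} {c : ℝ} (hc : 0 ≤ c) (M : ℕ) (h : ∀ n, f n ≤ c) :
    (1 / (2 * M : ℝ)) * ∑ n ∈ window M, f n ≤ c := by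
  -- For `M = 0` the average is `1 / 0` times an empty sum, hence `0`; this is where `0 ≤ c` enters.
  rcases eq_or_ne M 0 with rfl | hM
  · simpa using hc
  · calc _ ≤ (1 / (2 * M : ℝ)) * ∑ _n ∈ window M, c := by
          gcongr with n _; exact h n
      _ = c := average_const hM c

theorem IsUnitaryBasis.integrable_diagAverage {θ : ℤ → ℝ → ℂ} (hθ : IsUnitaryBasis θ) (M : ℕ) :
    Integrable (diagAverage θ M) specMeasure :=
  (integrable_finsetSum _ fun n _ => integrable_norm_sq (hθ.memLp n)).const_mul _

theorem IsUnitaryBasis.integral_norm_sq {θ : ℤ → ℝ → ℂ} (hθ : IsUnitaryBasis θ) (n : ℤ) :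
    ∫ s, ‖θ n s‖ ^ 2 ∂specMeasure = 1 := by
  simpa using hθ.integral_norm_sq_sum {n} 1

theorem IsUnitaryBasis.tendsto_integral_diagAverage {θ : ℤ → ℝ → ℂ} (hθ : IsUnitaryBasis θ) :
    Tendsto (fun M => ∫ s, diagAverage θ M s ∂specMeasure) atTop (𝓝 1) := by
  refine tendsto_const_nhds.congr' ?_
  filter_upwards [eventually_ne_atTop 0] with M hM
  simp only [diagAverage]
  rw [integral_const_mul, integral_finsetSum _ fun n _ => integrable_norm_sq (hθ.memLp n)]
  simp_rw [hθ.integral_norm_sq]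
  exact (average_const hM 1).symm

theorem IsUnitaryBasis.tendsto_integral_abs_diagAverage_sub_one {θ : ℤ → ℝ → ℂ}
    (hθ : IsUnitaryBasis θ) :
    Tendsto (fun M => ∫ s, |diagAverage θ M s - 1| ∂specMeasure) atTop (𝓝 0) :=
  tendsto_integral_abs_sub_one hθ.integrable_diagAverage (diagAverage_nonneg θ)
    hθ.tendsto_integral_diagAverage hθ.normalized

/-! ### Tails of summable convolution kernels -/

/-- The part of the row `l ↦ b (k - l)` outside a window. -/
noncomputable def tailSum (b : ℤ → ℝ) (M : ℕ) (k : ℤ) : ℝ :=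
  ∑' l, if l ∈ window M then 0 else b (k - l)

theorem summable_tail {b : ℤ → ℝ} (hb : Summable b) (hb0 : ∀ m, 0 ≤ b m) (M : ℕ) (k : ℤ) :
    Summable fun l => if l ∈ window M then 0 else b (k - l) := by
  refine Summable.of_nonneg_of_le (fun l => ?_) (fun l => ?_)
    ((Equiv.subLeft k).summable_iff.2 hb)
  · split_ifs
    exacts [le_rfl, hb0 _]
  · simp only [Function.comp, Equiv.subLeft_apply]
    split_ifs
    exacts [hb0 _, le_rfl]

/-- The empty window leaves the whole row, so residual estimates at `M = 0` become bounds on the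
full product `S φ(k)`. -/
theorem tailSum_zero (b : ℤ → ℝ) (k : ℤ) : tailSum b 0 k = ∑' m, b m := by
  simp only [tailSum, window, Nat.cast_zero, neg_zero, Finset.Ico_self, Finset.notMem_empty,
    if_false]
  exact (Equiv.subLeft k).tsum_eq b

theorem sum_sdiff_le_tailSum {b : ℤ → ℝ} (hb : Summable b) (hb0 : ∀ m, 0 ≤ b m) (M : ℕ) (k : ℤ)
    (F : Finset ℤ) : ∑ l ∈ F \ window M, b (k - l) ≤ tailSum b M k := by
  calc ∑ l ∈ F \ window M, b (k - l)
      = ∑ l ∈ F \ window M, if l ∈ window M then 0 else b (k - l) :=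
        Finset.sum_congr rfl fun l hl => (if_neg (Finset.mem_sdiff.1 hl).2).symm
    _ ≤ tailSum b M k := by
        refine (summable_tail hb hb0 M k).sum_le_tsum _ fun l _ => ?_
        split_ifs
        exacts [le_rfl, hb0 _]

/-- A shift by `m` pushes out only points in a strip of width `|m|` at one end of the window. -/
theorem card_filter_sub_notMem_window_le (M : ℕ) (m : ℤ) :
    ((window M).filter fun k => k - m ∉ window M).card ≤ m.natAbs := by
  rcases le_total 0 m with h | h
  · calc _ ≤ (Finset.Ico (-(M : ℤ)) (-M + m)).card := by
          refine Finset.card_le_card fun k hk => ?_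
          simp only [window, Finset.mem_filter, Finset.mem_Ico] at hk ⊢
          omega
      _ = m.natAbs := by simp; omega
  · calc _ ≤ (Finset.Ico ((M : ℤ) + m) M).card := by
          refine Finset.card_le_card fun k hk => ?_
          simp only [window, Finset.mem_filter, Finset.mem_Ico] at hk ⊢
          omega
      _ = m.natAbs := by simp; omega

/-- The rows of a summable convolution kernel lose a vanishing fraction of their mass, on average
over the window, when they are restricted to the window. -/
theorem tendsto_average_tailSum {b : ℤ → ℝ} (hb : Summable b) (hb0 : ∀ m, 0 ≤ b m) :
    Tendsto (fun M : ℕ => (1 / (2 * M : ℝ)) * ∑ k ∈ window M, tailSum b M k) atTop (𝓝 0) := by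
  -- After exchanging the sums, `b m` is weighted by the fraction of the window that a shift by `m`
  -- expels. This is at most `1` and at most `|m| / (2 * M)`, so dominated convergence applies with
  -- bound `b`.
  set w : ℕ → ℤ → ℝ := fun M m =>
    (1 / (2 * M : ℝ)) * ((window M).filter fun k => k - m ∉ window M).card with hw
  have heq : ∀ M : ℕ, (1 / (2 * M : ℝ)) * ∑ k ∈ window M, tailSum b M k = ∑' m, w M m * b m := by
    intro M
    have h1 : ∀ k, tailSum b M k = ∑' m, if k - m ∈ window M then 0 else b m := fun k => by
      rw [tailSum, ← (Equiv.subLeft k).tsum_eq]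
      simp
    have h2 : ∀ k, Summable fun m => if k - m ∈ window M then 0 else b m := fun k => by
      refine ((Equiv.subLeft k).summable_iff.2 (summable_tail hb hb0 M k)).congr fun m => ?_
      simp
    simp_rw [h1]
    rw [← Summable.tsum_finsetSum fun k _ => h2 k, ← tsum_mul_left]
    refine tsum_congr fun m => ?_
    simp only [hw, Finset.sum_ite, Finset.sum_const_zero, zero_add, Finset.sum_const, nsmul_eq_mul]
    ring
  have hw0 : ∀ M m, 0 ≤ w M m := fun M m => by simp only [hw]; positivity
  have hw1 : ∀ M m, w M m ≤ 1 := fun M m => by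
    rcases Nat.eq_zero_or_pos M with rfl | hM
    · simp [hw]
    · have : (0 : ℝ) < 2 * M := by positivity
      simp only [hw, one_div]
      rw [inv_mul_le_iff₀ this, mul_one]
      have := (Finset.card_filter_le (window M) fun k => k - m ∉ window M).trans_eq (card_window M)
      exact_mod_cast this
  have hlim : ∀ m, Tendsto (fun M => w M m) atTop (𝓝 0) := fun m => by
    have hz : Tendsto (fun M : ℕ => (m.natAbs : ℝ) / 2 * (1 / (M : ℝ))) atTop (𝓝 0) := by
      simpa using tendsto_one_div_atTop_nhds_zero_nat.const_mul ((m.natAbs : ℝ) / 2)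
    refine squeeze_zero (fun M => hw0 M m) (fun M => ?_) hz
    have := card_filter_sub_notMem_window_le M m
    calc w M m ≤ (1 / (2 * M : ℝ)) * (m.natAbs : ℝ) := by
          simp only [hw]; gcongr
      _ = _ := by ring
  simp_rw [heq]
  have := tendsto_tsum_of_dominated_convergence (f := fun M m => w M m * b m)
    (g := fun _ => (0 : ℝ)) (𝓕 := atTop) (bound := b) hb
    (fun m => by simpa using (hlim m).mul_const (b m))
    (.of_forall fun M m => by
      rw [Real.norm_of_nonneg (mul_nonneg (hw0 M m) (hb0 m))]
      exact mul_le_of_le_one_left (hb0 m) (hw1 M m))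
  simpa using this

/-! ### The correlation operator as multiplication by the spectrum -/

/-- The matrix `R`, dominated by a summable convolution kernel, acts as multiplication by `S` on
the unitary basis `φ`. -/
structure IsDiagonalized (R : ℤ → ℤ → ℂ) (b : ℤ → ℝ) (φ : ℤ → ℝ → ℂ) (S : ℝ → ℝ) : Prop where
  unitary : IsUnitaryBasis φ
  summable : Summable b
  nonneg : ∀ m, 0 ≤ b m
  bound : ∀ k l, ‖R k l‖ ^ 2 ≤ b (k - l)
  eigen : ∀ k : ℤ, TendstoInMeasure specMeasure
    (fun (M : ℕ) s => ∑ l ∈ window M, R k l * φ l s) atTop (fun s => (S s : ℂ) * φ k s)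

/-- The inequality of arithmetic and geometric means, integrated. -/
theorem integral_norm_mul_norm_le {α : Type*} [MeasurableSpace α] {μ : Measure α} {f g : α → ℂ}
    (hf : MemLp f 2 μ) (hg : MemLp g 2 μ) {ε : ℝ} (hε : 0 < ε) :
    ∫ s, ‖g s‖ * ‖f s‖ ∂μ ≤ ε / 2 * ∫ s, ‖g s‖ ^ 2 ∂μ + ε⁻¹ / 2 * ∫ s, ‖f s‖ ^ 2 ∂μ := by
  have hg2 := (integrable_norm_sq hg).const_mul (ε / 2)
  have hf2 := (integrable_norm_sq hf).const_mul (ε⁻¹ / 2)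
  rw [← integral_const_mul, ← integral_const_mul, ← integral_add hg2 hf2]
  refine integral_mono (hg.norm.integrable_mul hf.norm) (hg2.add hf2) fun s => ?_
  have h : 0 ≤ ε⁻¹ / 2 * (ε * ‖g s‖ - ‖f s‖) ^ 2 := by positivity
  have e : ε⁻¹ / 2 * (ε * ‖g s‖ - ‖f s‖) ^ 2
      = ε / 2 * ‖g s‖ ^ 2 + ε⁻¹ / 2 * ‖f s‖ ^ 2 - ‖g s‖ * ‖f s‖ := by
    field_simp; ring
  change ‖g s‖ * ‖f s‖ ≤ ε / 2 * ‖g s‖ ^ 2 + ε⁻¹ / 2 * ‖f s‖ ^ 2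
  linarith

theorem tendsto_tailSum {b : ℤ → ℝ} (hb : Summable b) (hb0 : ∀ m, 0 ≤ b m) (k : ℤ) :
    Tendsto (fun M : ℕ => tailSum b M k) atTop (𝓝 0) := by
  have := tendsto_tsum_of_dominated_convergence
    (f := fun (M : ℕ) l => if l ∈ window M then 0 else b (k - l))
    (g := fun _ => (0 : ℝ)) (𝓕 := atTop) ((Equiv.subLeft k).summable_iff.2 hb)
    (fun l => by
      refine tendsto_const_nhds.congr' ?_
      filter_upwards [eventually_gt_atTop l.natAbs] with M hM
      rw [if_pos]
      simp only [window, Finset.mem_Ico]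
      omega)
    (.of_forall fun M l => by
      simp only [Function.comp, Equiv.subLeft_apply]
      split_ifs
      · simpa using hb0 _
      · rw [Real.norm_of_nonneg (hb0 _)])
  simpa [tailSum] using this

theorem mul_diagAverage (φ : ℤ → ℝ → ℂ) (M : ℕ) (s a : ℝ) :
    a * diagAverage φ M s = (1 / (2 * M : ℝ)) * ∑ k ∈ window M, a * ‖φ k s‖ ^ 2 := by
  rw [diagAverage, mul_left_comm, Finset.mul_sum]

theorem window_subset_window {M M' : ℕ} (h : M ≤ M') : window M ⊆ window M' := by
  intro l hl
  simp only [window, Finset.mem_Ico] at hl ⊢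
  omega

namespace IsDiagonalized

variable {R : ℤ → ℤ → ℂ} {b : ℤ → ℝ} {φ : ℤ → ℝ → ℂ} {S : ℝ → ℝ}

theorem memLp_partial (h : IsDiagonalized R b φ S) (M : ℕ) (k : ℤ) :
    MemLp (fun s => ∑ l ∈ window M, R k l * φ l s) 2 specMeasure :=
  memLp_sum_mul h.unitary.memLp _ _

theorem aestronglyMeasurable_mul (h : IsDiagonalized R b φ S) (k : ℤ) :
    AEStronglyMeasurable (fun s => (S s : ℂ) * φ k s) specMeasure :=
  (h.eigen k).aestronglyMeasurable fun M => (h.memLp_partial M k).1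

/-- Two partial sums differ by a finite combination over indices outside the smaller window, whose
squared norm Parseval bounds by the tail. Fatou along an a.e. convergent subsequence passes to the
limit. -/
theorem integrable_and_integral_residual_le (h : IsDiagonalized R b φ S) (M : ℕ) (k : ℤ) :
    Integrable (fun s => ‖(S s : ℂ) * φ k s - ∑ l ∈ window M, R k l * φ l s‖ ^ 2) specMeasure ∧
      ∫ s, ‖(S s : ℂ) * φ k s - ∑ l ∈ window M, R k l * φ l s‖ ^ 2 ∂specMeasure
        ≤ tailSum b M k := by
  obtain ⟨ns, hns, hlim⟩ := (h.eigen k).exists_seq_tendsto_ae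
  have hle : ∀ i, M ≤ ns (i + M) := fun i => (Nat.le_add_left M i).trans (hns.id_le _)
  refine integrable_and_integral_le_of_tendsto'
    (u := fun i s => ‖∑ l ∈ window (ns (i + M)), R k l * φ l s
      - ∑ l ∈ window M, R k l * φ l s‖ ^ 2) (c := fun _ => tailSum b M k)
    (fun i => integrable_norm_sq ((h.memLp_partial _ k).sub (h.memLp_partial M k)))
    (fun i => .of_forall fun s => by positivity) (fun i => ?_) tendsto_const_nhds ?_
  · simp_rw [← Finset.sum_sdiff_eq_sub (window_subset_window (hle i))]
    rw [h.unitary.integral_norm_sq_sum]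
    exact (Finset.sum_le_sum fun l _ => h.bound k l).trans
      (sum_sdiff_le_tailSum h.summable h.nonneg M k _)
  · filter_upwards [hlim] with s hs
    exact (((tendsto_add_atTop_iff_nat M).2 hs).sub_const _).norm.pow 2

theorem memLp_residual (h : IsDiagonalized R b φ S) (M : ℕ) (k : ℤ) :
    MemLp (fun s => (S s : ℂ) * φ k s - ∑ l ∈ window M, R k l * φ l s) 2 specMeasure :=
  (memLp_two_iff_integrable_sq_norm
    ((h.aestronglyMeasurable_mul k).sub (h.memLp_partial M k).1)).2
    (h.integrable_and_integral_residual_le M k).1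

theorem memLp_mul (h : IsDiagonalized R b φ S) (k : ℤ) :
    MemLp (fun s => (S s : ℂ) * φ k s) 2 specMeasure := by
  simpa [window] using h.memLp_residual 0 k

theorem integral_norm_mul_sq_le (h : IsDiagonalized R b φ S) (k : ℤ) :
    ∫ s, ‖(S s : ℂ) * φ k s‖ ^ 2 ∂specMeasure ≤ ∑' m, b m := by
  have := (h.integrable_and_integral_residual_le 0 k).2
  rw [tailSum_zero] at this
  simpa [window] using this

/-- The matrix entries of the multiplication operator. -/
theorem integral_mul_star (h : IsDiagonalized R b φ S) (k l : ℤ) :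
    ∫ s, (S s : ℂ) * φ k s * star (φ l s) ∂specMeasure = R k l := by
  rw [← sub_eq_zero, ← norm_le_zero_iff]
  refine le_of_forall_pos_le_add fun ε hε => ?_
  -- Once `l` is in the window, orthonormality makes the entry of the truncated row exactly `R k l`;
  -- the residual contributes at most `ε / 2` plus a multiple of the vanishing tail.
  have hlim : Tendsto (fun M : ℕ => ε / 2 + ε⁻¹ / 2 * tailSum b M k) atTop (𝓝 (ε / 2)) := by
    simpa using ((tendsto_tailSum h.summable h.nonneg k).const_mul (ε⁻¹ / 2)).const_add (ε / 2)
  refine (ge_of_tendsto hlim ?_).trans (by linarith)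
  filter_upwards [eventually_gt_atTop l.natAbs] with M hM
  have hmem : l ∈ window M := by simp only [window, Finset.mem_Ico]; omega
  have hT : ∫ s, (∑ j ∈ window M, R k j * φ j s) * star (φ l s) ∂specMeasure = R k l := by
    simp_rw [Finset.sum_mul, mul_assoc]
    rw [integral_finsetSum _ fun j _ =>
      (integrable_mul_star (h.unitary.memLp j) (h.unitary.memLp l)).const_mul _]
    simp_rw [integral_const_mul, h.unitary.orthonormal]
    simp [hmem]
  rw [← hT]
  rw [← integral_sub (integrable_mul_star (h.memLp_mul k) (h.unitary.memLp l))
    (integrable_mul_star (h.memLp_partial M k) (h.unitary.memLp l))]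
  calc _ ≤ ∫ s, ‖(S s : ℂ) * φ k s * star (φ l s)
          - (∑ j ∈ window M, R k j * φ j s) * star (φ l s)‖ ∂specMeasure :=
        norm_integral_le_integral_norm _
    _ = ∫ s, ‖φ l s‖ * ‖(S s : ℂ) * φ k s - ∑ j ∈ window M, R k j * φ j s‖ ∂specMeasure := by
        refine integral_congr_ae (.of_forall fun s => ?_)
        simp only
        rw [← sub_mul, norm_mul, norm_star, mul_comm]
    _ ≤ _ := integral_norm_mul_norm_le (h.memLp_residual M k) (h.unitary.memLp l) hε
    _ ≤ _ := by
        rw [h.unitary.integral_norm_sq, mul_one]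
        gcongr
        exact (h.integrable_and_integral_residual_le M k).2

/-- Only the products `S φ(n)` are known to be measurable. Multiplying by `φ*(n)` and averaging
gives `S * diagAverage φ`, which tends to `S` a.e. along a subsequence. -/
theorem aestronglyMeasurable (h : IsDiagonalized R b φ S) :
    AEStronglyMeasurable S specMeasure := by
  obtain ⟨ns, -, hns⟩ := TendstoInMeasure.exists_seq_tendsto_ae h.unitary.normalized
  refine aestronglyMeasurable_of_tendsto_ae atTop
    (f := fun i s => S s * diagAverage φ (ns i) s) (fun i => ?_) ?_
  · have h1 : AEStronglyMeasurable (fun s => (1 / (2 * ns i : ℝ)) *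
        ∑ n ∈ window (ns i), Complex.re ((S s : ℂ) * φ n s * star (φ n s))) specMeasure :=
      (integrable_finsetSum _ fun n _ =>
        (integrable_mul_star (h.memLp_mul n) (h.unitary.memLp n)).re).1.const_mul _
    refine h1.congr (.of_forall fun s => ?_)
    simp only [mul_diagAverage]
    congr 1
    refine Finset.sum_congr rfl fun n _ => ?_
    have := Complex.mul_conj' (φ n s)
    rw [mul_assoc, ← starRingEnd_apply, this]
    norm_cast
  · filter_upwards [hns] with s hs
    simpa [diagAverage] using hs.const_mul (S s)

theorem integrable_sq_mul_norm_sq (h : IsDiagonalized R b φ S) (k : ℤ) :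
    Integrable (fun s => S s ^ 2 * ‖φ k s‖ ^ 2) specMeasure := by
  simpa [mul_pow] using integrable_norm_sq (h.memLp_mul k)

theorem integrable_sq_mul_diagAverage (h : IsDiagonalized R b φ S) (M : ℕ) :
    Integrable (fun s => S s ^ 2 * diagAverage φ M s) specMeasure := by
  simp only [mul_diagAverage]
  exact (integrable_finsetSum _ fun k _ => h.integrable_sq_mul_norm_sq k).const_mul _

theorem tsum_nonneg (h : IsDiagonalized R b φ S) : 0 ≤ ∑' m, b m := _root_.tsum_nonneg h.nonneg

theorem integral_sq_mul_diagAverage_le (h : IsDiagonalized R b φ S) (M : ℕ) :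
    ∫ s, S s ^ 2 * diagAverage φ M s ∂specMeasure ≤ ∑' m, b m := by
  simp_rw [mul_diagAverage]
  rw [integral_const_mul, integral_finsetSum _ fun k _ => h.integrable_sq_mul_norm_sq k]
  refine average_le h.tsum_nonneg M fun k => ?_
  simpa [mul_pow] using h.integral_norm_mul_sq_le k

/-- The weighted means of `S²` are bounded by `∑ b`, and Fatou removes the weights, which tend to
`1`. -/
theorem integrable_sq_and_integral_sq_le (h : IsDiagonalized R b φ S) :
    Integrable (fun s => S s ^ 2) specMeasure ∧ ∫ s, S s ^ 2 ∂specMeasure ≤ ∑' m, b m := by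
  obtain ⟨ns, -, hns⟩ := TendstoInMeasure.exists_seq_tendsto_ae h.unitary.normalized
  refine integrable_and_integral_le_of_tendsto' (u := fun i s => S s ^ 2 * diagAverage φ (ns i) s)
    (fun i => h.integrable_sq_mul_diagAverage _)
    (fun i => .of_forall fun s => mul_nonneg (sq_nonneg _) (diagAverage_nonneg _ _ _))
    (fun i => h.integral_sq_mul_diagAverage_le _) tendsto_const_nhds ?_
  filter_upwards [hns] with s hs
  simpa [diagAverage] using hs.const_mul (S s ^ 2)

/-- Functions of subquadratic growth in the spectrum are recovered from the diagonal averages. -/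
theorem tendsto_integral_mul_diagAverage (h : IsDiagonalized R b φ S) {f : ℝ → ℝ}
    (hf : AEStronglyMeasurable f specMeasure)
    (hfS : ∀ ε > 0, ∃ C, ∀ᵐ s ∂specMeasure, |f s| ≤ ε * S s ^ 2 + C) :
    Integrable f specMeasure ∧
      (∀ M, Integrable (fun s => f s * diagAverage φ M s) specMeasure) ∧
      Tendsto (fun M => ∫ s, |f s * diagAverage φ M s - f s| ∂specMeasure) atTop (𝓝 0) ∧
      Tendsto (fun M => ∫ s, f s * diagAverage φ M s ∂specMeasure) atTop
        (𝓝 (∫ s, f s ∂specMeasure)) := by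
  obtain ⟨h1, h2, h3⟩ := tendsto_integral_mul_abs_sub_one h.unitary.integrable_diagAverage
    (diagAverage_nonneg φ) h.unitary.tendsto_integral_abs_diagAverage_sub_one
    h.integrable_sq_and_integral_sq_le.1 h.integrable_sq_and_integral_sq_le.2
    h.integrable_sq_mul_diagAverage h.integral_sq_mul_diagAverage_le hf hfS
  refine ⟨h1, h2, h3, ?_⟩
  rw [tendsto_iff_norm_sub_tendsto_zero]
  refine squeeze_zero (fun _ => norm_nonneg _) (fun M => ?_) h3
  rw [← integral_sub (h2 M) h1]
  exact norm_integral_le_integral_norm _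

theorem abs_le_sq (S : ℝ → ℝ) : ∀ ε > 0, ∃ C, ∀ᵐ s ∂specMeasure, |S s| ≤ ε * S s ^ 2 + C := by
  intro ε hε
  refine ⟨ε⁻¹, .of_forall fun s => ?_⟩
  rw [← sq_abs (S s)]
  have h1 : 0 ≤ ε⁻¹ * ((ε * |S s| - 1) ^ 2 + ε * |S s|) := by positivity
  have h2 : ε⁻¹ * ((ε * |S s| - 1) ^ 2 + ε * |S s|) = ε * |S s| ^ 2 + ε⁻¹ - |S s| := by
    field_simp; ring
  linarith

/-- The integrals of `S |φ(k)|²` are the diagonal entries of `R`; this ties the mass of `S` to the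
average power. -/
theorem integral_diagAverage_mul (h : IsDiagonalized R b φ S) (M : ℕ) :
    ((∫ s, S s * diagAverage φ M s ∂specMeasure : ℝ) : ℂ) =
      (1 / (2 * M : ℂ)) * ∑ k ∈ window M, R k k := by
  rw [← integral_complex_ofReal]
  simp_rw [← h.integral_mul_star]
  rw [← integral_finsetSum _ fun k _ =>
    (integrable_mul_star (h.memLp_mul k) (h.unitary.memLp k)), ← integral_const_mul]
  refine integral_congr_ae (.of_forall fun s => ?_)
  simp only [diagAverage]
  push_cast
  rw [mul_left_comm, Finset.mul_sum]
  congr 1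
  refine Finset.sum_congr rfl fun n _ => ?_
  rw [mul_assoc, ← starRingEnd_apply, Complex.mul_conj']

/-- Replacing each truncated row by `S φ(k)` turns `u` into `S * diagAverage φ`, which tends to `S`
in mean. The replacement costs at most `ε / 2` plus a multiple of the averaged tails, which vanish.
-/
theorem tendsto_integral_abs_sub (h : IsDiagonalized R b φ S) {u : ℕ → ℝ → ℝ}
    (hu : ∀ M s, (u M s : ℂ) = (1 / (2 * M : ℂ)) *
      ∑ k ∈ window M, star (φ k s) * ∑ l ∈ window M, R k l * φ l s) :
    (∀ M, Integrable (u M) specMeasure) ∧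
      Tendsto (fun M => ∫ s, |u M s - S s| ∂specMeasure) atTop (𝓝 0) := by
  have hui : ∀ M, Integrable (u M) specMeasure := by
    intro M
    have : Integrable (fun s => (1 / (2 * M : ℂ)) *
        ∑ k ∈ window M, star (φ k s) * ∑ l ∈ window M, R k l * φ l s) specMeasure :=
      (integrable_finsetSum _ fun k _ =>
        (h.unitary.memLp k).star.integrable_mul (h.memLp_partial M k)).const_mul _
    refine this.re.congr (.of_forall fun s => ?_)
    simp only [← hu]
    simp
  refine ⟨hui, ?_⟩
  obtain ⟨hSi, hSg, hlim, -⟩ :=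
    h.tendsto_integral_mul_diagAverage h.aestronglyMeasurable (abs_le_sq S)
  set r : ℕ → ℤ → ℝ → ℝ := fun M k s =>
    ‖φ k s‖ * ‖(S s : ℂ) * φ k s - ∑ l ∈ window M, R k l * φ l s‖ with hr
  have hri : ∀ M k, Integrable (r M k) specMeasure := fun M k =>
    (h.unitary.memLp k).norm.integrable_mul (h.memLp_residual M k).norm
  have hpt : ∀ M s, |u M s - S s| ≤
      |S s * diagAverage φ M s - S s| + (1 / (2 * M : ℝ)) * ∑ k ∈ window M, r M k s := by
    intro M s
    have e : ((u M s - S s * diagAverage φ M s : ℝ) : ℂ) = -((1 / (2 * M : ℂ)) *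
        ∑ k ∈ window M, star (φ k s) *
          ((S s : ℂ) * φ k s - ∑ l ∈ window M, R k l * φ l s)) := by
      push_cast
      simp only [hu, diagAverage, mul_sub, Finset.sum_sub_distrib]
      push_cast
      have : ∑ k ∈ window M, star (φ k s) * ((S s : ℂ) * φ k s)
          = (S s : ℂ) * ∑ k ∈ window M, (‖φ k s‖ : ℂ) ^ 2 := by
        rw [Finset.mul_sum]
        refine Finset.sum_congr rfl fun k _ => ?_
        rw [← Complex.mul_conj', starRingEnd_apply]; ring
      rw [this]; ring
    have hb : |u M s - S s * diagAverage φ M s| ≤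
        (1 / (2 * M : ℝ)) * ∑ k ∈ window M, r M k s := by
      rw [← Real.norm_eq_abs, ← Complex.norm_real, e, norm_neg, norm_mul]
      have : ‖(1 / (2 * M : ℂ))‖ = 1 / (2 * M : ℝ) := by simp
      rw [this]
      gcongr
      refine (norm_sum_le _ _).trans (Finset.sum_le_sum fun k _ => ?_)
      rw [norm_mul, norm_star]
    have := abs_sub_le (u M s) (S s * diagAverage φ M s) (S s)
    linarith
  have hint : ∀ M, ∀ ε > 0, ∫ s, |u M s - S s| ∂specMeasure ≤
      ∫ s, |S s * diagAverage φ M s - S s| ∂specMeasure +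
        (ε / 2 + ε⁻¹ / 2 * ((1 / (2 * M : ℝ)) * ∑ k ∈ window M, tailSum b M k)) := by
    intro M ε hε
    have h1 : Integrable (fun s => |S s * diagAverage φ M s - S s|) specMeasure :=
      ((hSg M).sub hSi).abs
    have h2 : Integrable (fun s => (1 / (2 * M : ℝ)) * ∑ k ∈ window M, r M k s) specMeasure :=
      (integrable_finsetSum _ fun k _ => hri M k).const_mul _
    refine (integral_mono ((hui M).sub hSi).abs (h1.add h2) (hpt M)).trans ?_
    rw [integral_add' h1 h2, integral_const_mul, integral_finsetSum _ fun k _ => hri M k]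
    gcongr
    calc (1 / (2 * M : ℝ)) * ∑ k ∈ window M, ∫ s, r M k s ∂specMeasure
        ≤ (1 / (2 * M : ℝ)) * ∑ k ∈ window M, (ε / 2 + ε⁻¹ / 2 * tailSum b M k) := by
          gcongr with k _
          refine (integral_norm_mul_norm_le (h.memLp_residual M k) (h.unitary.memLp k) hε).trans ?_
          rw [h.unitary.integral_norm_sq, mul_one]
          gcongr
          exact (h.integrable_and_integral_residual_le M k).2
      _ = (1 / (2 * M : ℝ)) * ∑ k ∈ window M, ε / 2 +
          ε⁻¹ / 2 * ((1 / (2 * M : ℝ)) * ∑ k ∈ window M, tailSum b M k) := by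
          rw [Finset.sum_add_distrib, mul_add, ← Finset.mul_sum, mul_left_comm]
      _ ≤ _ := by
          gcongr
          exact average_le (by positivity) M fun _ => le_rfl
  rw [Metric.tendsto_atTop]
  intro ε hε
  have hT := hlim.add (((tendsto_average_tailSum h.summable h.nonneg).const_mul
    (ε⁻¹ / 2)).const_add (ε / 2))
  have hlt : (0 : ℝ) + (ε / 2 + ε⁻¹ / 2 * 0) < ε := by linarith
  obtain ⟨N, hN⟩ := eventually_atTop.1 (hT.eventually (gt_mem_nhds hlt))
  refine ⟨N, fun M hM => ?_⟩
  rw [Real.dist_eq, sub_zero, abs_of_nonneg (integral_nonneg fun s => abs_nonneg _)]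
  exact (hint M ε hε).trans_lt (hN M hM)

end IsDiagonalized

/-! ### The transition kernel and the convex order -/

/-- The squared modulus of the partial sums of the change of basis kernel from `φ` to `θ`. -/
noncomputable def transition (θ φ : ℤ → ℝ → ℂ) (M : ℕ) (s s' : ℝ) : ℝ :=
  (1 / (2 * M : ℝ)) * ‖∑ k ∈ window M, star (θ k s) * φ k s'‖ ^ 2

theorem transition_nonneg (θ φ : ℤ → ℝ → ℂ) (M : ℕ) (s s' : ℝ) : 0 ≤ transition θ φ M s s' := by
  unfold transition; positivity

theorem transition_comm (θ φ : ℤ → ℝ → ℂ) (M : ℕ) (s s' : ℝ) :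
    transition θ φ M s s' = transition φ θ M s' s := by
  rw [transition, transition, ← norm_star (∑ k ∈ window M, star (θ k s) * φ k s'), star_sum]
  simp only [star_mul', star_star]
  congr 3
  exact Finset.sum_congr rfl fun k _ => mul_comm _ _

theorem IsUnitaryBasis.integrable_transition {φ : ℤ → ℝ → ℂ} (hφ : IsUnitaryBasis φ)
    (θ : ℤ → ℝ → ℂ) (M : ℕ) (s : ℝ) : Integrable (transition θ φ M s) specMeasure :=
  (integrable_norm_sq (memLp_sum_mul hφ.memLp _ _)).const_mul _

/-- Parseval in `s'` with coefficients `θ*(k, s)`. Together with `transition_comm` it gives both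
marginals of the kernel. -/
theorem IsUnitaryBasis.integral_transition {φ : ℤ → ℝ → ℂ} (hφ : IsUnitaryBasis φ)
    (θ : ℤ → ℝ → ℂ) (M : ℕ) (s : ℝ) :
    ∫ s', transition θ φ M s s' ∂specMeasure = diagAverage θ M s := by
  simp only [transition, diagAverage]
  rw [integral_const_mul, hφ.integral_norm_sq_sum]
  simp

theorem aestronglyMeasurable_transition {θ φ : ℤ → ℝ → ℂ} (hθ : IsUnitaryBasis θ)
    (hφ : IsUnitaryBasis φ) (M : ℕ) :
    AEStronglyMeasurable (fun p : ℝ × ℝ => transition θ φ M p.1 p.2)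
      (specMeasure.prod specMeasure) := by
  have h : AEStronglyMeasurable (fun p : ℝ × ℝ => ∑ k ∈ window M, star (θ k p.1) * φ k p.2)
      (specMeasure.prod specMeasure) :=
    Finset.aestronglyMeasurable_fun_sum _ fun k _ =>
      ((hθ.memLp k).1.comp_fst.star).mul (hφ.memLp k).1.comp_snd
  exact (h.norm.pow 2).const_mul _

namespace IsDiagonalized

variable {R : ℤ → ℤ → ℂ} {b : ℤ → ℝ} {φ : ℤ → ℝ → ℂ} {S : ℝ → ℝ}

/-- Expanding the square leaves the matrix entries of multiplication by `S`, which are those of `R`;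
so the quadratic form in `θ` is an average of `S`. -/
theorem integrable_mul_transition_and_integral_eq (h : IsDiagonalized R b φ S)
    (θ : ℤ → ℝ → ℂ) (M : ℕ) (s : ℝ) :
    Integrable (fun s' => S s' * transition θ φ M s s') specMeasure ∧
      ((∫ s', S s' * transition θ φ M s s' ∂specMeasure : ℝ) : ℂ) = (1 / (2 * M : ℂ)) *
        ∑ k ∈ window M, star (θ k s) * ∑ l ∈ window M, R k l * θ l s := by
  have hi : ∀ k l, Integrable (fun s' => star (θ k s) * θ l s *
      ((S s' : ℂ) * φ k s' * star (φ l s'))) specMeasure := fun k l =>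
    (integrable_mul_star (h.memLp_mul k) (h.unitary.memLp l)).const_mul _
  have e : ∀ s', ((S s' * transition θ φ M s s' : ℝ) : ℂ) = (1 / (2 * M : ℂ)) *
      ∑ k ∈ window M, ∑ l ∈ window M, star (θ k s) * θ l s *
        ((S s' : ℂ) * φ k s' * star (φ l s')) := by
    intro s'
    simp only [transition]
    push_cast
    rw [← Complex.mul_conj', starRingEnd_apply, star_sum, Finset.sum_mul_sum, mul_left_comm,
      Finset.mul_sum]
    congr 1
    refine Finset.sum_congr rfl fun k _ => ?_
    rw [Finset.mul_sum]
    refine Finset.sum_congr rfl fun l _ => ?_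
    rw [star_mul', star_star]
    ring
  have hsum : Integrable (fun s' => (1 / (2 * M : ℂ)) * ∑ k ∈ window M, ∑ l ∈ window M,
      star (θ k s) * θ l s * ((S s' : ℂ) * φ k s' * star (φ l s'))) specMeasure :=
    (integrable_finsetSum _ fun k _ => integrable_finsetSum _ fun l _ => hi k l).const_mul _
  refine ⟨hsum.re.congr (.of_forall fun s' => ?_), ?_⟩
  · simp only [← e]
    simp
  · rw [← integral_complex_ofReal]
    simp_rw [e]
    rw [integral_const_mul, integral_finsetSum _ fun k _ => integrable_finsetSum _ fun l _ => hi k l]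
    congr 1
    refine Finset.sum_congr rfl fun k _ => ?_
    rw [integral_finsetSum _ fun l _ => hi k l, Finset.mul_sum]
    refine Finset.sum_congr rfl fun l _ => ?_
    rw [integral_const_mul, h.integral_mul_star]
    ring

/-- The spectrum in any basis is dominated by the Karhunen–Loève spectrum in the convex order. -/
theorem integrable_and_integral_map_le (h : IsDiagonalized R b φ S)
    (hS0 : ∀ᵐ s ∂specMeasure, 0 ≤ S s) {θ : ℤ → ℝ → ℂ} (hθ : IsUnitaryBasis θ)
    {u : ℕ → ℝ → ℝ} {T : ℝ → ℝ} (hu : ∀ M s, (u M s : ℂ) = (1 / (2 * M : ℂ)) *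
      ∑ k ∈ window M, star (θ k s) * ∑ l ∈ window M, R k l * θ l s)
    (hT : TendstoInMeasure specMeasure u atTop T) {Φ : ℝ → ℝ}
    (hΦ : ConvexOn ℝ (Set.Ici 0) Φ) (hΦc : Continuous Φ) (hΦ0 : ∀ t, 0 ≤ t → 0 ≤ Φ t)
    (hΦ2 : ∀ ε > 0, ∃ C, ∀ t, 0 ≤ t → Φ t ≤ ε * t ^ 2 + C) :
    Integrable (fun s => Φ (T s)) specMeasure ∧ Integrable (fun s => Φ (S s)) specMeasure ∧
      ∫ s, Φ (T s) ∂specMeasure ≤ ∫ s, Φ (S s) ∂specMeasure := by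
  have hΦS : AEStronglyMeasurable (fun s => Φ (S s)) specMeasure :=
    hΦc.comp_aestronglyMeasurable h.aestronglyMeasurable
  have hΦS0 : ∀ᵐ s ∂specMeasure, 0 ≤ Φ (S s) := hS0.mono fun s hs => hΦ0 _ hs
  obtain ⟨hΦSi, hΦSg, -, hlim⟩ := h.tendsto_integral_mul_diagAverage hΦS fun ε hε => by
    obtain ⟨C, hC⟩ := hΦ2 ε hε
    refine ⟨C, hS0.mono fun s hs => ?_⟩
    rw [abs_of_nonneg (hΦ0 _ hs)]
    exact hC _ hs
  have hueq : ∀ M s, u M s = ∫ s', S s' * transition θ φ M s s' ∂specMeasure := fun M s =>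
    Complex.ofReal_injective
      ((hu M s).trans (h.integrable_mul_transition_and_integral_eq θ M s).2.symm)
  have hu0 : ∀ M s, 0 ≤ u M s := fun M s => by
    rw [hueq]
    exact integral_nonneg_of_ae (hS0.mono fun s' hs' => mul_nonneg hs' (transition_nonneg _ _ _ _ _))
  have hum : ∀ M, AEMeasurable (u M) specMeasure := fun M => by
    have : Integrable (fun s => (1 / (2 * M : ℂ)) *
        ∑ k ∈ window M, star (θ k s) * ∑ l ∈ window M, R k l * θ l s) specMeasure :=
      (integrable_finsetSum _ fun k _ =>
        (hθ.memLp k).star.integrable_mul (memLp_sum_mul hθ.memLp _ _)).const_mul _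
    refine (this.re.congr (.of_forall fun s => ?_)).1.aemeasurable
    simp only [← hu]
    simp
  have hgm : ∀ M, AEMeasurable (diagAverage θ M) specMeasure :=
    fun M => (hθ.integrable_diagAverage M).1.aemeasurable
  have key : ∀ M, ∫⁻ s, ENNReal.ofReal (Φ (u M s / diagAverage θ M s) * diagAverage θ M s)
      ∂specMeasure ≤ ENNReal.ofReal (∫ s, Φ (S s) * diagAverage φ M s ∂specMeasure) := by
    intro M
    calc _ ≤ ∫⁻ s, ∫⁻ s', ENNReal.ofReal (Φ (S s') * transition θ φ M s s')
            ∂specMeasure ∂specMeasure := by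
          -- Jensen in `s'` at fixed `s`: the kernel has mass `diagAverage θ M s`, and `u M s` is
          -- the integral of `S` against it.
          refine lintegral_mono fun s => ?_
          rw [hueq, ← h.unitary.integral_transition]
          exact ofReal_map_average_mul_le hΦ hΦc hΦ0 (h.unitary.integrable_transition θ M s)
            (transition_nonneg θ φ M s) h.aestronglyMeasurable hS0
            (h.integrable_mul_transition_and_integral_eq θ M s).1
      _ = ∫⁻ s', ∫⁻ s, ENNReal.ofReal (Φ (S s') * transition θ φ M s s')
            ∂specMeasure ∂specMeasure := by
          refine lintegral_lintegral_swap ?_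
          exact (hΦS.comp_snd.mul
            (aestronglyMeasurable_transition hθ h.unitary M)).aemeasurable.ennreal_ofReal
      _ = ∫⁻ s', ENNReal.ofReal (Φ (S s') * diagAverage φ M s') ∂specMeasure := by
          refine lintegral_congr_ae (hΦS0.mono fun s' hs' => ?_)
          simp only [transition_comm θ φ]
          rw [← ofReal_integral_eq_lintegral_ofReal
            ((hθ.integrable_transition φ M s').const_mul _)
            (.of_forall fun s => mul_nonneg hs' (transition_nonneg _ _ _ _ _)),
            integral_const_mul, hθ.integral_transition]
      _ = _ := by
          rw [ofReal_integral_eq_lintegral_ofReal (hΦSg M)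
            (hΦS0.mono fun s hs => mul_nonneg hs (diagAverage_nonneg _ _ _))]
  -- Nested subsequences make `u` tend to `T` and the weights `diagAverage θ` to `1` a.e. together,
  -- so the normalized integrand tends to `Φ (T s)`.
  obtain ⟨ns, hns, hns'⟩ := hT.exists_seq_tendsto_ae
  obtain ⟨ms, hms, hms'⟩ :=
    (TendstoInMeasure.comp hθ.normalized hns.tendsto_atTop).exists_seq_tendsto_ae
  have hfin := integrable_and_integral_le_of_tendsto
    (u := fun i s => Φ (u (ns (ms i)) s / diagAverage θ (ns (ms i)) s) *
      diagAverage θ (ns (ms i)) s) (v := fun s => Φ (T s))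
    (fun i => (hΦc.measurable.comp_aemeasurable ((hum _).div (hgm _))).mul (hgm _))
    (fun i => .of_forall fun s => mul_nonneg
      (hΦ0 _ (div_nonneg (hu0 _ _) (diagAverage_nonneg _ _ _))) (diagAverage_nonneg _ _ _))
    (fun i => key (ns (ms i))) (hlim.comp (hns.comp hms).tendsto_atTop) ?_
    (integral_nonneg_of_ae hΦS0)
  · exact ⟨hfin.1, hΦSi, hfin.2⟩
  · filter_upwards [hns', hms'] with s h1 h2
    have h1' := h1.comp hms.tendsto_atTop
    have h3 := ((hΦc.tendsto _).comp (h1'.div h2 one_ne_zero)).mul h2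
    simpa [diagAverage] using h3

end IsDiagonalized

/-! ### Entropy as a convex functional -/

/-- The entropy integrand, shifted to be nonnegative. -/
noncomputable def shiftedEntropy (P t : ℝ) : ℝ := t / P * Real.log (t / P) + 1

theorem convexOn_shiftedEntropy {P : ℝ} (hP : 0 < P) :
    ConvexOn ℝ (Set.Ici 0) (shiftedEntropy P) := by
  have h := (Real.convexOn_mul_log.comp_linearMap (LinearMap.mulRight ℝ P⁻¹)).add_const 1
  have hset : (LinearMap.mulRight ℝ P⁻¹) ⁻¹' Set.Ici 0 = Set.Ici 0 := by
    ext t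
    simp [hP]
  rw [hset] at h
  exact h

theorem continuous_shiftedEntropy (P : ℝ) : Continuous (shiftedEntropy P) :=
  (Real.continuous_mul_log.comp (continuous_id.div_const P)).add_const 1

theorem shiftedEntropy_nonneg {P : ℝ} (hP : 0 < P) {t : ℝ} (ht : 0 ≤ t) :
    0 ≤ shiftedEntropy P t := by
  have := Real.self_sub_one_le_mul_log (div_nonneg ht hP.le)
  have := div_nonneg ht hP.le
  unfold shiftedEntropy
  linarith

theorem shiftedEntropy_le {P : ℝ} (hP : 0 < P) {ε : ℝ} (hε : 0 < ε) :
    ∃ C, ∀ t, 0 ≤ t → shiftedEntropy P t ≤ ε * t ^ 2 + C := by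
  -- With `p = t / P`, `ε * t ^ 2 = 2 * δ * p ^ 2`. The bound `log (δ p) ≤ δ p - 1` spends one `δ *
  -- p ^ 2`; completing the square absorbs `-p * log δ` into the other, at the price of the
  -- constant.
  set δ := ε * P ^ 2 / 2 with hδ
  have hδ0 : 0 < δ := by positivity
  refine ⟨δ⁻¹ * Real.log δ ^ 2 + 1, fun t ht => ?_⟩
  have hp : 0 ≤ t / P := div_nonneg ht hP.le
  have e : ε * t ^ 2 = 2 * δ * (t / P) ^ 2 := by rw [hδ]; field_simp
  rw [shiftedEntropy, e]
  generalize t / P = p at hp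
  have hsq : 0 ≤ δ⁻¹ * (δ * p + Real.log δ) ^ 2 := by positivity
  have hsq' : δ⁻¹ * (δ * p + Real.log δ) ^ 2
      = δ * p ^ 2 + 2 * p * Real.log δ + δ⁻¹ * Real.log δ ^ 2 := by
    field_simp; ring
  rcases hp.eq_or_lt with rfl | hp
  · simp; positivity
  have hlog := Real.log_le_sub_one_of_pos (mul_pos hδ0 hp)
  rw [Real.log_mul hδ0.ne' hp.ne'] at hlog
  have h1 : p * Real.log p ≤ p * (δ * p - 1 - Real.log δ) := by gcongr; linarith
  have h2 : 0 ≤ δ⁻¹ * (δ * p + Real.log δ) ^ 2 + δ⁻¹ * Real.log δ ^ 2 := by positivity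
  nlinarith

namespace IsDiagonalized

variable {R : ℤ → ℤ → ℂ} {b : ℤ → ℝ} {φ : ℤ → ℝ → ℂ} {S : ℝ → ℝ}

theorem integral_eq_of_tendsto_trace (h : IsDiagonalized R b φ S) {P : ℝ} {t : ℕ → ℝ}
    (ht : ∀ M, (t M : ℂ) = (1 / (2 * M : ℂ)) * ∑ k ∈ window M, R k k)
    (htP : Tendsto t atTop (𝓝 P)) : ∫ s, S s ∂specMeasure = P := by
  obtain ⟨-, -, -, hlim⟩ :=
    h.tendsto_integral_mul_diagAverage h.aestronglyMeasurable (abs_le_sq S)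
  refine tendsto_nhds_unique hlim (htP.congr fun M => Complex.ofReal_injective ?_)
  rw [ht, h.integral_diagAverage_mul]

/-- Every spectrum has the same total mass as the Karhunen–Loève spectrum. -/
theorem integral_eq_integral (h : IsDiagonalized R b φ S)
    (hS0 : ∀ᵐ s ∂specMeasure, 0 ≤ S s) {T : ℝ → ℝ}
    (hconv : ∀ Φ : ℝ → ℝ, ConvexOn ℝ (Set.Ici 0) Φ → Continuous Φ → (∀ t, 0 ≤ t → 0 ≤ Φ t) →
      (∀ ε > 0, ∃ C, ∀ t, 0 ≤ t → Φ t ≤ ε * t ^ 2 + C) →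
      Integrable (fun s => Φ (T s)) specMeasure ∧ Integrable (fun s => Φ (S s)) specMeasure ∧
        ∫ s, Φ (T s) ∂specMeasure ≤ ∫ s, Φ (S s) ∂specMeasure) :
    Integrable T specMeasure ∧ Integrable S specMeasure ∧
      ∫ s, T s ∂specMeasure = ∫ s, S s ∂specMeasure := by
  obtain ⟨hTi, hSi, hle⟩ := hconv (fun t => t) (convexOn_id (convex_Ici 0)) continuous_id
    (fun t ht => ht) fun ε hε => by
      refine ⟨ε⁻¹, fun t ht => ?_⟩
      have h1 : 0 ≤ ε⁻¹ * ((ε * t - 1) ^ 2 + ε * t) := by positivity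
      have h2 : ε⁻¹ * ((ε * t - 1) ^ 2 + ε * t) = ε * t ^ 2 + ε⁻¹ - t := by
        field_simp; ring
      linarith
  refine ⟨hTi, hSi, le_antisymm hle ?_⟩
  -- The reverse inequality excludes loss of mass at large values. The test function `(K - t)⁺`
  -- gives `K - ∫ T ≤ ∫ (K - S)⁺`, and `(K - S)⁺ ≤ K - S + S² / K` leaves an error `O(1 / K)`.
  have hK : ∀ K : ℕ, 0 < K →
      ∫ s, S s ∂specMeasure - (∑' m, b m) * (1 / (K : ℝ)) ≤ ∫ s, T s ∂specMeasure := by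
    intro K hK
    have hK0 : (0 : ℝ) < K := by exact_mod_cast hK
    obtain ⟨h1, h2, h3⟩ := hconv (fun t => max ((K : ℝ) - t) 0)
      (((convexOn_const (K : ℝ) (convex_Ici 0)).sub (concaveOn_id (convex_Ici 0))).sup
        (convexOn_const 0 (convex_Ici 0)))
      ((continuous_const.sub continuous_id).max continuous_const)
      (fun t _ => le_max_right _ _) fun ε hε => by
        refine ⟨K, fun t ht => ?_⟩
        have : 0 ≤ ε * t ^ 2 := by positivity
        exact max_le (by linarith) (by linarith)
    have h4 : K - ∫ s, T s ∂specMeasure ≤ ∫ s, max ((K : ℝ) - T s) 0 ∂specMeasure := by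
      have : K - ∫ s, T s ∂specMeasure = ∫ s, ((K : ℝ) - T s) ∂specMeasure := by
        rw [integral_sub (integrable_const _) hTi]; simp
      rw [this]
      exact integral_mono ((integrable_const _).sub hTi) h1 fun s => le_max_left _ _
    have hq : Integrable (fun s => S s ^ 2 * (1 / (K : ℝ))) specMeasure :=
      h.integrable_sq_and_integral_sq_le.1.mul_const _
    have hd : Integrable (fun s => (K : ℝ) - S s) specMeasure := (integrable_const _).sub hSi
    have h5 : ∫ s, max ((K : ℝ) - S s) 0 ∂specMeasure ≤
        ∫ s, (((K : ℝ) - S s) + S s ^ 2 * (1 / (K : ℝ))) ∂specMeasure := by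
      refine integral_mono_ae h2 (hd.add hq) (hS0.mono fun s hs => ?_)
      have e : ((K : ℝ) - S s) + S s ^ 2 * (1 / (K : ℝ))
          = (1 / (K : ℝ)) * ((S s - K / 2) ^ 2 + 3 / 4 * (K : ℝ) ^ 2) := by
        field_simp; ring
      refine max_le ?_ ?_
      · have : 0 ≤ S s ^ 2 * (1 / (K : ℝ)) := by positivity
        simp only
        linarith
      · simp only
        rw [e]; positivity
    rw [integral_add hd hq, integral_sub (integrable_const _) hSi, integral_mul_const] at h5
    have h6 : (∫ s, S s ^ 2 ∂specMeasure) * (1 / (K : ℝ)) ≤ (∑' m, b m) * (1 / (K : ℝ)) := by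
      gcongr
      exact h.integrable_sq_and_integral_sq_le.2
    simp only [integral_const, probReal_univ, one_smul] at h5
    linarith
  have hlim := (tendsto_one_div_atTop_nhds_zero_nat (𝕜 := ℝ)).const_mul (∑' m, b m)
  have hlim' := hlim.const_sub (∫ s, S s ∂specMeasure)
  rw [mul_zero, sub_zero] at hlim'
  exact le_of_tendsto hlim' ((eventually_gt_atTop 0).mono hK)

/-- The entropy in any basis is defined and at least the Karhunen–Loève entropy. -/
theorem entropyDefined_and_repEntropy_le (h : IsDiagonalized R b φ S)
    (hS0 : ∀ᵐ s ∂specMeasure, 0 ≤ S s) {P : ℝ} (hP : 0 < P) (hSP : ∫ s, S s ∂specMeasure = P)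
    {θ : ℤ → ℝ → ℂ} (hθ : IsUnitaryBasis θ)
    {u : ℕ → ℝ → ℝ} {T : ℝ → ℝ} (hu : ∀ M s, (u M s : ℂ) = (1 / (2 * M : ℂ)) *
      ∑ k ∈ window M, star (θ k s) * ∑ l ∈ window M, R k l * θ l s)
    (hT : TendstoInMeasure specMeasure u atTop T) (hT0 : ∀ᵐ s ∂specMeasure, 0 ≤ T s) :
    EntropyDefined P T ∧ repEntropy P S ≤ repEntropy P T := by
  have hconv := fun Φ h1 h2 h3 h4 =>
    h.integrable_and_integral_map_le hS0 hθ hu hT (Φ := Φ) h1 h2 h3 h4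
  obtain ⟨hTi, hSi, hTS⟩ := h.integral_eq_integral hS0 hconv
  obtain ⟨h1, h2, h3⟩ := hconv (shiftedEntropy P) (convexOn_shiftedEntropy hP)
    (continuous_shiftedEntropy P) (fun t => shiftedEntropy_nonneg hP)
    fun ε hε => shiftedEntropy_le hP hε
  have hsub : ∀ V : ℝ → ℝ, (fun s => normSpectrum P V s * Real.log (normSpectrum P V s))
      = fun s => shiftedEntropy P (V s) - 1 := fun V => by
    funext s
    simp [shiftedEntropy, normSpectrum]
  refine ⟨⟨?_, hTi.div_const P, ?_, ?_⟩, ?_⟩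
  · exact hT0.mono fun s hs => div_nonneg hs hP.le
  · simp only [normSpectrum]
    rw [integral_div, hTS, hSP, div_self hP.ne']
  · rw [hsub]
    exact h1.sub (integrable_const _)
  · simp only [repEntropy, hsub]
    -- The shift contributes the same constant on both sides.
    rw [integral_sub h1 (integrable_const _), integral_sub h2 (integrable_const _)]
    linarith

end IsDiagonalized

/-! ### From the random process to its correlation matrix -/

theorem ae_nonneg_of_tendstoInMeasure {α : Type*} [MeasurableSpace α] {μ : Measure α}
    {u : ℕ → α → ℝ} {T : α → ℝ} (hu : ∀ M s, 0 ≤ u M s) (hT : TendstoInMeasure μ u atTop T) :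
    ∀ᵐ s ∂μ, 0 ≤ T s := by
  obtain ⟨ns, -, hns⟩ := hT.exists_seq_tendsto_ae
  filter_upwards [hns] with s hs using ge_of_tendsto' hs fun i => hu _ s

theorem autocorr_sub {Ω : Type*} [MeasurableSpace Ω] (Pr : Measure Ω) (x : ℤ → Ω → ℂ) (k l : ℤ) :
    autocorr Pr x l (k - l) = ∫ ω, x k ω * star (x l ω) ∂Pr := by
  rw [autocorr, add_sub_cancel]

/-- The periodogram as a quadratic form in the correlation matrix. -/
theorem ofReal_periodogram {Ω : Type*} [MeasurableSpace Ω] {Pr : Measure Ω} {x : ℤ → Ω → ℂ}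
    (hx : ∀ n, MemLp (x n) 2 Pr) (θ : ℤ → ℝ → ℂ) (M : ℕ) (s : ℝ) :
    (((1 / (2 * M : ℝ)) * ∫ ω, ‖∑ n ∈ window M, x n ω * star (θ n s)‖ ^ 2 ∂Pr : ℝ) : ℂ) =
      (1 / (2 * M : ℂ)) * ∑ k ∈ window M, star (θ k s) *
        ∑ l ∈ window M, autocorr Pr x l (k - l) * θ l s := by
  have h := ofReal_integral_norm_sq_sum hx (window M) fun n => star (θ n s)
  simp only [mul_comm (star (θ _ s)) (x _ _), ← autocorr_sub, star_star] at h
  rw [Complex.ofReal_mul, h]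
  push_cast
  congr 1
  refine Finset.sum_congr rfl fun k _ => ?_
  rw [Finset.mul_sum]
  exact Finset.sum_congr rfl fun l _ => by ring

end SpectralEntropy

theorem proposition1 {Ω : Type*} [MeasurableSpace Ω] (Pr : MeasureTheory.Measure Ω)
    [MeasureTheory.IsProbabilityMeasure Pr]
    (x : ℤ → Ω → ℂ) (hx : ∀ n, MeasureTheory.MemLp (x n) 2 Pr)
    (hr : SpectralEntropy.SquareSummableAutocorr Pr x)
    (P : ℝ) (hP : SpectralEntropy.HasAveragePower Pr x P) (hP0 : 0 < P)
    (φ : ℤ → ℝ → ℂ) (S : ℝ → ℝ) (hφ : SpectralEntropy.IsKLBasis Pr x φ S) :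
    SpectralEntropy.HasSpectrum Pr x φ S ∧ SpectralEntropy.EntropyDefined P S ∧
      ∀ (θ : ℤ → ℝ → ℂ) (Sθ : ℝ → ℝ), SpectralEntropy.IsUnitaryBasis θ →
        SpectralEntropy.HasSpectrum Pr x θ Sθ →
          SpectralEntropy.EntropyDefined P Sθ ∧
            SpectralEntropy.repEntropy P S ≤ SpectralEntropy.repEntropy P Sθ := by
  open SpectralEntropy MeasureTheory Filter Topology in
  obtain ⟨a, ha, hra⟩ := hr
  have hD : IsDiagonalized (fun k l => autocorr Pr x l (k - l)) (fun m => a m ^ 2) φ S :=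
    ⟨hφ.unitary, ha, fun m => sq_nonneg _,
      fun k l => pow_le_pow_left₀ (norm_nonneg _) (hra _ _) 2, hφ.eigen⟩
  have hSP : ∫ s, S s ∂specMeasure = P := by
    refine hD.integral_eq_of_tendsto_trace (fun M => ?_) hP
    push_cast
    congr 1
    refine Finset.sum_congr rfl fun k _ => ?_
    rw [autocorr_sub, ofReal_integral_norm_sq]
  obtain ⟨hui, hlim⟩ := hD.tendsto_integral_abs_sub (ofReal_periodogram hx φ)
  -- A non-integrable function has integral `0` by convention, whereas `P` is positive.
  have hSi : Integrable S specMeasure := not_imp_comm.1 integral_undef (hSP ▸ hP0.ne')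
  have hspec : HasSpectrum Pr x φ S := tendstoInMeasure_of_tendsto_integral_abs hui hSi hlim
  have hnonneg : ∀ (θ : ℤ → ℝ → ℂ) (T : ℝ → ℝ), HasSpectrum Pr x θ T →
      ∀ᵐ s ∂specMeasure, 0 ≤ T s := fun θ T hT =>
    ae_nonneg_of_tendstoInMeasure (fun M s => by positivity) hT
  have hmain := fun (θ : ℤ → ℝ → ℂ) (T : ℝ → ℝ) (hθ : IsUnitaryBasis θ)
      (hT : HasSpectrum Pr x θ T) =>
    hD.entropyDefined_and_repEntropy_le (hnonneg φ S hspec) hP0 hSP hθ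
      (ofReal_periodogram hx θ) hT (hnonneg θ T hT)
  -- `φ` is itself a unitary basis with spectrum `S`, so its entropy is covered by the general case.
  exact ⟨hspec, (hmain φ S hφ.unitary hspec).1, hmain⟩
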